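/- Let $N\ge 2$. A family $(h_i)_{0\le i\le N-1}$ of strictly increasing continuous maps $[0,1]\to[0,1]$ is a *compatible system* if $h_0(0)=0$, $h_{i-1}(1)=h_i(0)$ for $1\le i\le N-1$, and $h_{N-1}(1)=1$. It is a *contractive system* if moreover $\mathrm{Lip}(h_i)=\sup_{x\ne y}|h_i(x)-h_i(y)|/|x-y|<1$ for every $i$. Let $(g_i)_{0\le i\le N-1}$ be an LF system with $d_i=1$: $g_i(x)=\frac{a_ix+b_i}{c_ix+1}$ on $[0,1]$ with real $a_i,b_i,c_i$ such that $c_i+1>0$, $0<a_i-b_ic_i\le\min\{1,(c_i+1)^2\}$, $b_0=0$, and $\frac{a_i+b_i}{c_i+1}=b_{i+1}$ for $0\le i\le N-1$, where $b_N:=1$. Put $y_0=\frac{c_0}{1-a_0}$ ($:=+\infty$ if $a_0=1$), $y_i=\frac{a_i-1+\sqrt{(1-a_i)^2+4b_ic_i}}{2b_i}$ for $1\le i\le N-1$, $\alpha=\min\{0,y_0,\dots,y_{N-1}\}$, $\beta=\max\{0,y_0,\dots,y_{N-1}\}$ and $Y=[\alpha,\beta]\subset[-1,+\infty]$. For $y\in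 Y$ let $$G_i(y)=\frac{(a_i-b_ic_i)(y+1)}{(b_iy+1)\left((a_i+b_i)y+c_i+1\right)},\qquad H_i(y)=\frac{a_iy+c_i}{b_iy+1},$$ where the value of $G_{N-1}$ at $y=-1$ is the limit $1$, and the values at $+\infty$ are the limits $G_0(+\infty)=1$, $H_0(+\infty)=+\infty$, and $G_i(+\infty)=0$, $H_i(+\infty)=a_i/b_i$ for $i\ge1$. Let $\mathfrak p_i=\left(G_0(y),\dots,G_{N-1}(y)\right)$, where $y$ is the fixed point of $H_i$ in $Y$. Suppose that $\mathfrak p_0,\dots,\mathfrak p_{N-1}$ are not all equal. Then for every $\varepsilon\in(0,1/2)$ there is $\delta>0$ with the following property. Let $(f_i)_{0\le i\le N-1}$ be any contractive system whose Lipschitz constants $r_i=\mathrm{Lip}(f_i)$ satisfy $\varepsilon\le r_i\le1-\varepsilon$ for all $i$ and $\sum_i r_i<1+\delta$, and let $\varphi:[0,1]\to[0,1]$ be the continuous strictly increasing solution of $g_i\circ\varphi=\varphi\circ f_i$ $(0\le i\le N-1)$. Let $\mu_\varphi$ be the Borel probability measure on $[0,1]$ with distribution function $\varphi$. Then $$\dim_H\mu_\varphi:=\inf\{\dim_HA: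 A\subset[0,1]\text{ Borel},\ \mu_\varphi(A)=1\}<1,$$ and hence $\varphi$ is singular: it is strictly increasing and continuous, and $\varphi'=0$ Lebesgue-almost everywhere. -/

import Mathlib

open Set MeasureTheory
open scoped unitInterval ENNReal

noncomputable section

/-- A compatible system: a family of `N` strictly increasing continuous self-maps of `[0,1]` with
`h₀ 0 = 0`, `h_{i-1} 1 = h_i 0` for `1 ≤ i ≤ N - 1`, and `h_{N-1} 1 = 1`. -/
structure IsCompatibleSystem {N : ℕ} (h : Fin N → I → I) : Prop where
  strictMono : ∀ i, StrictMono (h i)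
  continuous : ∀ i, Continuous (h i)
  first : ∀ i : Fin N, (i : ℕ) = 0 → h i 0 = 0
  step : ∀ i j : Fin N, (i : ℕ) + 1 = (j : ℕ) → h i 1 = h j 0
  last : ∀ i : Fin N, (i : ℕ) + 1 = N → h i 1 = 1

/-- The Lipschitz constant `sup_{x ≠ y} |h x - h y| / |x - y|`, possibly `∞`. -/
def lipConst (h : I → I) : ℝ≥0∞ :=
  ⨆ (x : I) (y : I) (_ : x ≠ y), ENNReal.ofReal (|(h x : ℝ) - h y| / |(x : ℝ) - y|)

/-- A contractive system: a compatible system all of whose maps are contractions. -/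
structure IsContractiveSystem {N : ℕ} (h : Fin N → I → I) : Prop where
  compatible : IsCompatibleSystem h
  contraction : ∀ i, lipConst (h i) < 1

/-- `h` is the LF system on `[0,1]` with coefficients `a, b, c, d`, that is
`h_i x = (a_i x + b_i) / (c_i x + d_i)`, where in the compatibility condition `b_N / d_N` is read
as `1`. -/
structure IsLFSystem {N : ℕ} (h : Fin N → I → I) (a b c d : Fin N → ℝ) : Prop where
  eq_lf : ∀ i x, (h i x : ℝ) = (a i * x + b i) / (c i * x + d i)
  cd_pos : ∀ i, 0 < c i + d i
  d_pos : ∀ i, 0 < d i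
  det_pos : ∀ i, 0 < a i * d i - b i * c i
  det_le : ∀ i, a i * d i - b i * c i ≤ min (d i ^ 2) ((c i + d i) ^ 2)
  first : ∀ i : Fin N, (i : ℕ) = 0 → b i = 0
  step : ∀ i j : Fin N, (i : ℕ) + 1 = (j : ℕ) → (a i + b i) / (c i + d i) = b j / d j
  last : ∀ i : Fin N, (i : ℕ) + 1 = N → (a i + b i) / (c i + d i) = 1

/-- `φ` is the continuous strictly increasing solution of `g_i ∘ φ = φ ∘ f_i`. -/
structure IsConjSolution {N : ℕ} (f g : Fin N → I → I) (φ : I → I) : Prop where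
  continuous : Continuous φ
  strictMono : StrictMono φ
  conj : ∀ i, g i ∘ φ = φ ∘ f i

/-- The numbers `c₀ / (1 - a₀)` (read as `+∞` if `a₀ = 1`) for `i = 0`, and
`(a_i - 1 + √((1 - a_i)² + 4 b_i c_i)) / (2 b_i)` for `i ≥ 1`. -/
def lfNode {N : ℕ} (a b c : Fin N → ℝ) (i : Fin N) : EReal :=
  if (i : ℕ) = 0 then
    if a i = 1 then ⊤ else ((c i / (1 - a i) : ℝ) : EReal)
  else (((a i - 1 + √((1 - a i) ^ 2 + 4 * b i * c i)) / (2 * b i) : ℝ) : EReal)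

/-- The left end point `α`. (An entry `+∞` does not influence a minimum that contains `0`, so it
need not be deleted.) -/
def lfAlpha {N : ℕ} (a b c : Fin N → ℝ) : EReal := min 0 (⨅ i, lfNode a b c i)

/-- The right end point `β`. -/
def lfBeta {N : ℕ} (a b c : Fin N → ℝ) : EReal := max 0 (⨆ i, lfNode a b c i)

/-- The interval `Y = [α, β]` in the extended reals. -/
def lfY {N : ℕ} (a b c : Fin N → ℝ) : Set EReal := Icc (lfAlpha a b c) (lfBeta a b c)

/-- `G_i y = (a_i - b_i c_i)(y + 1) / ((b_i y + 1)((a_i + b_i) y + (c_i + 1)))`, extended to `+∞`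
by its limits `1` (for `i = 0`) and `0` (for `i ≥ 1`). For `i = N - 1` one has
`a_i + b_i = c_i + 1`, so that the quotient has a removable singularity at `y = -1`,
which is filled in by its limit `1`. -/
def lfG {N : ℕ} (a b c : Fin N → ℝ) (i : Fin N) (y : EReal) : ℝ :=
  if y = ⊤ then (if (i : ℕ) = 0 then 1 else 0)
  else if y = -1 ∧ (i : ℕ) + 1 = N then 1
  else (a i - b i * c i) * (y.toReal + 1) /
    ((b i * y.toReal + 1) * ((a i + b i) * y.toReal + (c i + 1)))

/-- `H_i y = (a_i y + c_i) / (b_i y + 1)`, extended to `+∞` by its limits `+∞` (for `i = 0`) and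
`a_i / b_i` (for `i ≥ 1`). -/
def lfH {N : ℕ} (a b c : Fin N → ℝ) (i : Fin N) (y : EReal) : EReal :=
  if y = ⊤ then (if (i : ℕ) = 0 then ⊤ else ((a i / b i : ℝ) : EReal))
  else (((a i * y.toReal + c i) / (b i * y.toReal + 1) : ℝ) : EReal)

/-- The set of fixed points of `H_i` on `Y`. -/
def lfFix {N : ℕ} (a b c : Fin N → ℝ) (i : Fin N) : Set EReal :=
  {y | y ∈ lfY a b c ∧ lfH a b c i y = y}

/-- The set `{𝔭_i : i}` of the vectors `𝔭_i = (G_0 y, …, G_{N-1} y)`, `y` the fixed point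
of `H_i` on `Y`. -/
def lfFixVectors {N : ℕ} (a b c : Fin N → ℝ) : Set (Fin N → ℝ) :=
  {p | ∃ i, ∃ y ∈ lfFix a b c i, p = fun k => lfG a b c k y}

/-- `φ`, extended to the real line by the constants `φ 0` on the left and `φ 1` on the right. -/
def extendReal (φ : I → I) : ℝ → ℝ := IccExtend zero_le_one fun x => (φ x : ℝ)

/-- The measure `μ_φ` on the line with distribution function `φ`: it is carried by `[0,1]`
and gives `(x, y]` the mass `φ y - φ x`. -/
def distMeasure (φ : I → I) (hc : Continuous φ) (hm : StrictMono φ) : Measure ℝ :=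
  StieltjesFunction.measure
    { toFun := extendReal φ
      mono' := Monotone.IccExtend zero_le_one fun _ _ h => hm.monotone h
      right_continuous' := fun _ =>
        (Continuous.comp (continuous_subtype_val.comp hc)
          continuous_projIcc).continuousWithinAt }

/-- The Hausdorff dimension of a measure carried by `[0,1]`: the infimum of `dim_H A` over the
Borel sets `A ⊆ [0,1]` with `μ A = 1`. -/
def dimHMeasure (μ : Measure ℝ) : ℝ≥0∞ :=
  ⨅ (A : Set ℝ) (_ : MeasurableSet A) (_ : A ⊆ Icc 0 1) (_ : μ A = 1), dimH A

/-- `φ` is a singular function on `[0,1]`: strictly increasing and continuous, with derivative `0`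
at Lebesgue-almost every point. -/
structure IsSingularFunction (φ : I → I) : Prop where
  strictMono : StrictMono φ
  continuous : Continuous φ
  deriv_zero : ∀ᵐ x ∂(volume.restrict (Icc (0 : ℝ) 1)), HasDerivAt (extendReal φ) 0 x

end

/-!
Write the parameter `y ∈ [-1, ∞]` as `l = 1 / (y + 2) ∈ [0, 1]`. The LF homeomorphisms
`tiltMap l : x ↦ (y + 1) x / (y x + 1)` of `[0,1]` satisfy the cocycle identity
`IsLFData.tiltMap_lf`: the composition `tiltMap l ∘ g_i` is `tiltMap l'` followed by an affine map
of slope `G_i y`, where `l'` is the parameter of `H_i y`. Starting from `y = 0`, where the chart is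
the identity, it follows that the `μ_φ`-mass of the cylinder of a word `w` is the probability
`wordProb` that the Markov process, which in the state `y` emits the letter `i` with
probability `G_i y` and then moves to `H_i y`, emits `w`.

The diameter of the cylinder of `w` is at most `r_w = ∏ r_{w k}`. If `s ∈ (0,1)` is such that
`∑ √(M_w r_w ^ s)`, the sum over the words of length `2 n` with masses `M_w`, decays exponentially,
then by the Borel–Cantelli lemma almost every point eventually lies in cylinders with
`r_w ^ s ≤ M_w` only. Since `∑ M_w = 1`, these cylinders are covers with bounded `s`-dimensional
sums, and the dimension of `μ_φ` is at most `s` (`dimHMeasure_le_of_sum_sqrt_le`).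

The decay is a matter of two consecutive steps. For `∑ r_i ≤ 1` and `s = 1`, the inequality
between the arithmetic and the geometric mean bounds the two-step sum `twoStep` by `1`, with
equality only if the vector `(G_i y)_i` is equal to `r`, and likewise at every `H_i y`. As `G_0`
is injective, `y` is then a common fixed point of all the `H_i`. It lies in `(-1, ∞)` because
the `r_i` are positive, and then all the
vectors of `lfFixVectors` coincide (`lfFixVectors_subsingleton`), against the hypothesis. By
compactness the two-step sums are bounded away from `1`, uniformly in `y` and `r`, and this persists
for `∑ r_i` slightly above `1` and `s` slightly below `1` (`IsLFData.exists_twoStep_rpow_le`).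

Finally, a measure of dimension less than `1` is singular to Lebesgue measure, so that its
distribution function has derivative zero almost everywhere.
-/

/-! ### Coefficients and fixed points of LF systems -/

/-- The right end point `g_i 1 = (a_i + b_i) / (c_i + 1)` of the image of `g_i`. -/
noncomputable def lfEnd {N : ℕ} (a b c : Fin N → ℝ) (i : Fin N) : ℝ := (a i + b i) / (c i + 1)

/-- The consequences of `IsLFSystem` with `d = 1` that concern the coefficients only, apart from
the upper bounds on the determinants. -/
structure IsLFData {N : ℕ} (a b c : Fin N → ℝ) : Prop where
  c_pos : ∀ i, 0 < c i + 1
  b_nonneg : ∀ i, 0 ≤ b i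
  b_lt : ∀ i, b i < lfEnd a b c i
  end_le : ∀ i, lfEnd a b c i ≤ 1
  first : ∀ i : Fin N, (i : ℕ) = 0 → b i = 0
  step : ∀ i j : Fin N, (i : ℕ) + 1 = (j : ℕ) → lfEnd a b c i = b j
  last : ∀ i : Fin N, (i : ℕ) + 1 = N → lfEnd a b c i = 1

namespace IsLFData

variable {N : ℕ} {a b c : Fin N → ℝ}

theorem end_mul (h : IsLFData a b c) (i : Fin N) :
    lfEnd a b c i * (c i + 1) = a i + b i := by
  have := (h.c_pos i).ne'
  unfold lfEnd
  field_simp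

theorem b_pos (h : IsLFData a b c) {i : Fin N} (hi : (i : ℕ) ≠ 0) : 0 < b i := by
  have h1 := h.step ⟨i - 1, by omega⟩ i (by simp; omega)
  have h2 := h.b_lt ⟨i - 1, by omega⟩
  have h3 := h.b_nonneg ⟨i - 1, by omega⟩
  linarith

theorem end_lt_one (h : IsLFData a b c) {i : Fin N} (hi : (i : ℕ) + 1 ≠ N) :
    lfEnd a b c i < 1 := by
  have h1 := h.step i ⟨i + 1, by omega⟩ rfl
  have h2 := h.b_lt ⟨i + 1, by omega⟩
  have h3 := h.end_le ⟨i + 1, by omega⟩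
  linarith

theorem end_pos (h : IsLFData a b c) (i : Fin N) : 0 < lfEnd a b c i :=
  (h.b_nonneg i).trans_lt (h.b_lt i)

theorem b_lt_one (h : IsLFData a b c) (i : Fin N) : b i < 1 :=
  (h.b_lt i).trans_le (h.end_le i)

/-- Increments over the consecutive intervals `[b_i, (a_i + b_i) / (c_i + 1)]` telescope. -/
theorem sum_sub (h : IsLFData a b c) (hN : 0 < N) (T : ℝ → ℝ) :
    ∑ i, (T (lfEnd a b c i) - T (b i)) = T 1 - T 0 := by
  let E : ℕ → ℝ := fun k => if hk : k < N then b ⟨k, hk⟩ else 1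
  have h1 : ∀ i : Fin N, T (lfEnd a b c i) - T (b i) = T (E (i + 1)) - T (E i) := by
    intro i
    have e1 : E i = b i := by simp [E]
    have e2 : E (i + 1) = lfEnd a b c i := by
      by_cases hi : (i : ℕ) + 1 = N
      · simp [E, hi, h.last i hi]
      · have : (i : ℕ) + 1 < N := by omega
        simp [E, this, h.step i ⟨i + 1, this⟩ rfl]
    rw [e1, e2]
  simp_rw [h1]
  rw [Fin.sum_univ_eq_sum_range (fun k => T (E (k + 1)) - T (E k)) N,
    Finset.sum_range_sub (fun k => T (E k))]
  have e0 : E 0 = 0 := by simp [E, hN, h.first ⟨0, hN⟩ rfl]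
  have eN : E N = 1 := by simp [E]
  rw [e0, eN]

end IsLFData

section LFSystem

variable {N : ℕ} {g : Fin N → I → I} {a b c d : Fin N → ℝ}

theorem IsLFSystem.apply_eq (hg : IsLFSystem g a b c d) (hd : ∀ i, d i = 1) (i : Fin N) (x : I) :
    (g i x : ℝ) = (a i * x + b i) / (c i * x + 1) := by
  rw [hg.eq_lf, hd]

theorem IsLFSystem.isLFData (hg : IsLFSystem g a b c d) (hd : ∀ i, d i = 1) :
    IsLFData a b c := by
  have g0 : ∀ i, (g i 0 : ℝ) = b i := fun i => by simp [hg.apply_eq hd]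
  have g1 : ∀ i, (g i 1 : ℝ) = lfEnd a b c i := fun i => by simp [hg.apply_eq hd, lfEnd]
  have hc : ∀ i, 0 < c i + 1 := fun i => by simpa [hd] using hg.cd_pos i
  refine ⟨hc, fun i => g0 i ▸ (g i 0).2.1, fun i => ?_, fun i => g1 i ▸ (g i 1).2.2, hg.first,
    fun i j hij => by simpa [hd, lfEnd] using hg.step i j hij,
    fun i hi => by simpa [hd, lfEnd] using hg.last i hi⟩
  have h1 := hg.det_pos i
  rw [hd] at h1
  rw [lfEnd, lt_div_iff₀ (hc i)]
  linarith

/-- The fixed point `0` of `g_0` is its only one on `[0,1]`: another one, `x`, would satisfy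
`c_0 x + 1 = a_0`, which is impossible as `a_0 ≤ 1` and `a_0 < c_0 + 1`. -/
theorem IsLFSystem.eq_zero_of_fixed (hg : IsLFSystem g a b c d) (hd : ∀ i, d i = 1) (hN : 2 ≤ N)
    {i : Fin N} (hi : (i : ℕ) = 0) {x : I} (hx : g i x = x) : (x : ℝ) = 0 := by
  have h := hg.isLFData hd
  have h1 := hg.apply_eq hd i x
  have hdet := (hg.det_le i).trans (min_le_left _ _)
  have he := h.end_lt_one (i := i) (by omega)
  have hm := h.end_mul i
  have hc := h.c_pos i
  have hx0 := x.2.1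
  have hx1 := x.2.2
  rw [hx, h.first i hi] at h1
  rw [hd, h.first i hi] at hdet
  rw [h.first i hi] at hm
  by_contra hne
  have hxpos : (0 : ℝ) < x := lt_of_le_of_ne hx0 (Ne.symm hne)
  have hden : 0 < c i * x + 1 := by nlinarith
  rw [eq_div_iff hden.ne'] at h1
  have h2 : c i * x + 1 = a i := by
    apply mul_left_cancel₀ hne
    linarith
  have h3 : a i < c i + 1 := by nlinarith
  nlinarith

/-- The fixed point `1` of `g_{N-1}` is its only one on `[0,1]`: another one, `x`, would satisfy
`c_{N-1} x = -b_{N-1}`, whereas `c_{N-1} ≥ -b_{N-1}` by the bound on the determinant. -/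
theorem IsLFSystem.eq_one_of_fixed (hg : IsLFSystem g a b c d) (hd : ∀ i, d i = 1) (hN : 2 ≤ N)
    {i : Fin N} (hi : (i : ℕ) + 1 = N) {x : I} (hx : g i x = x) : (x : ℝ) = 1 := by
  have h := hg.isLFData hd
  have h1 := hg.apply_eq hd i x
  have hdet := (hg.det_le i).trans (min_le_right _ _)
  have hb := h.b_pos (i := i) (by omega)
  have hm := h.end_mul i
  have hc := h.c_pos i
  have hx0 := x.2.1
  have hx1 := x.2.2
  rw [h.last i hi] at hm
  rw [hx] at h1
  rw [hd] at hdet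
  have hden : 0 < c i * x + 1 := by nlinarith
  rw [eq_div_iff hden.ne'] at h1
  have ha : a i = c i + 1 - b i := by linarith
  rw [ha] at h1 hdet
  have hcb : -b i ≤ c i := by
    have : (c i + 1) * (1 - b i) ≤ (c i + 1) * (c i + 1) := by nlinarith
    have := le_of_mul_le_mul_left this hc
    linarith
  have hz : ((x : ℝ) - 1) * (c i * x + b i) = 0 := by linarith
  rcases mul_eq_zero.1 hz with h2 | h2
  · linarith
  · by_contra hne
    have : (x : ℝ) < 1 := lt_of_le_of_ne hx1 hne
    nlinarith

end LFSystem

/-! ### Fixed points of the maps `H_i` -/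

section FixedPoints

variable {N : ℕ} {a b c : Fin N → ℝ}

/-- If the maps `H_i` have a common fixed point `y` in `(-1, ∞)`, then all the numbers `lfNode`
are equal to `y`, and `y` is the only fixed point of any `H_i` on `Y`. -/
theorem lfFixVectors_subsingleton (h : IsLFData a b c) (hN : 2 ≤ N) {y : ℝ} (hy : -1 < y)
    (hfix : ∀ i, b i * y ^ 2 + (1 - a i) * y - c i = 0) :
    (lfFixVectors a b c).Subsingleton := by
  have : Nonempty (Fin N) := ⟨⟨0, by omega⟩⟩
  have ha : ∀ i : Fin N, (i : ℕ) = 0 → a i ≠ 1 := by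
    intro i hi ha
    have h1 := hfix i
    have h2 := h.end_lt_one (i := i) (by omega)
    have h3 := h.end_mul i
    rw [h.first i hi, ha] at h1 h3
    have : c i = 0 := by linarith
    rw [this] at h3
    linarith
  -- the quadratic is nonpositive at `-1`, so that `y` is its larger root
  have hneg : ∀ i, b i - (1 - a i) - c i ≤ 0 := by
    intro i
    have h2 := h.end_le i
    have h3 := h.end_mul i
    have h4 := h.c_pos i
    nlinarith
  have hnode : ∀ i, lfNode a b c i = (y : EReal) := by
    intro i
    have h1 := hfix i
    unfold lfNode
    split_ifs with hi hai
    · exact absurd hai (ha i hi)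
    · rw [h.first i hi] at h1
      have : 1 - a i ≠ 0 := sub_ne_zero.2 (Ne.symm hai)
      congr 1
      rw [div_eq_iff this]
      linarith
    · have hb := h.b_pos hi
      have h5 : 0 ≤ 2 * b i * y + (1 - a i) := by
        have : 0 ≤ (y + 1) * (b i * (y - 1) + (1 - a i)) := by
          have := hneg i
          nlinarith
        have := nonneg_of_mul_nonneg_right this (by linarith)
        nlinarith
      have h6 : (1 - a i) ^ 2 + 4 * b i * c i = (2 * b i * y + (1 - a i)) ^ 2 := by
        linear_combination (-4 * b i) * h1
      rw [h6, Real.sqrt_sq h5]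
      congr 1
      field_simp
      ring
  have hY : ∀ z ∈ lfY a b c, ∃ z' : ℝ, z = z' ∧ -1 < z' := by
    intro z hz
    have hz1 : min 0 (y : EReal) ≤ z := by
      have := hz.1
      simp only [lfAlpha, hnode, ciInf_const] at this
      exact this
    have hz2 : z ≤ max 0 (y : EReal) := by
      have := hz.2
      simp only [lfBeta, hnode, ciSup_const] at this
      exact this
    have e1 : min 0 (y : EReal) = ((min 0 y : ℝ) : EReal) := by
      rw [← EReal.coe_zero]; exact (EReal.coe_strictMono.monotone.map_min).symm
    have e2 : max 0 (y : EReal) = ((max 0 y : ℝ) : EReal) := by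
      rw [← EReal.coe_zero]; exact (EReal.coe_strictMono.monotone.map_max).symm
    rw [e1] at hz1
    rw [e2] at hz2
    induction z with
    | bot => simp at hz1
    | top => simp at hz2
    | coe z' =>
      refine ⟨z', rfl, ?_⟩
      rw [EReal.coe_le_coe_iff] at hz1
      exact lt_of_lt_of_le (lt_min (by norm_num) hy) hz1
  have huniq : ∀ i, ∀ z ∈ lfFix a b c i, z = (y : EReal) := by
    rintro i z ⟨hzY, hz⟩
    obtain ⟨z, rfl, hz1⟩ := hY z hzY
    rw [lfH, if_neg (EReal.coe_ne_top z), EReal.toReal_coe, EReal.coe_eq_coe_iff] at hz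
    have hden : b i * z + 1 ≠ 0 := by
      intro h0
      rw [h0, div_zero] at hz
      rw [← hz] at h0
      norm_num at h0
    rw [div_eq_iff hden] at hz
    have h1 := hfix i
    congr 1
    by_contra hne
    have h2 : b i * (z + y) + (1 - a i) = 0 := by
      apply mul_left_cancel₀ (sub_ne_zero.2 hne)
      linarith
    by_cases hi : (i : ℕ) = 0
    · rw [h.first i hi] at h2
      exact ha i hi (by linarith)
    · have hb := h.b_pos hi
      have h3 := hneg i
      -- the value at `-1` of the quadratic with roots `y, z > -1` is positive
      have h4 : b i - (1 - a i) - c i = b i * ((y + 1) * (z + 1)) := by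
        linear_combination h1 - (y + 1) * h2
      have : 0 < b i * ((y + 1) * (z + 1)) :=
        mul_pos hb (mul_pos (by linarith) (by linarith))
      linarith
  rintro p ⟨i, z, hz, rfl⟩ q ⟨j, w, hw, rfl⟩
  rw [huniq i z hz, huniq j w hw]

end FixedPoints

/-! ### The charts `tiltMap` and the cocycle identity -/

/-- The affine interpolation between `l` (at `x = 0`) and `1 - l` (at `x = 1`). -/
def tilt (l x : ℝ) : ℝ := (1 - l) * x + l * (1 - x)

/-- The orientation preserving LF homeomorphism `x ↦ (y + 1) x / (y x + 1)` of `[0,1]`, in terms of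
the parameter `l = 1 / (y + 2) ∈ [0,1]`. The value at `x = 1` is prescribed because for `l = 1` the
quotient degenerates there. -/
noncomputable def tiltMap (l x : ℝ) : ℝ := if x = 1 then 1 else (1 - l) * x / tilt l x

/-- The function `G_i` in terms of the parameter `l = 1 / (y + 2)`. -/
noncomputable def tiltProb {N : ℕ} (a b c : Fin N → ℝ) (i : Fin N) (l : ℝ) : ℝ :=
  tiltMap l (lfEnd a b c i) - tiltMap l (b i)

/-- The map `H_i` in terms of the parameter `l = 1 / (y + 2)`. -/
noncomputable def tiltNext {N : ℕ} (a b c : Fin N → ℝ) (i : Fin N) (l : ℝ) : ℝ :=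
  tilt l (b i) / (tilt l (b i) + (c i + 1) * tilt l (lfEnd a b c i))

section Tilt

variable {N : ℕ} {a b c : Fin N → ℝ} {l x x' : ℝ}

theorem tilt_nonneg (hl : l ∈ Icc (0 : ℝ) 1) (hx : x ∈ Icc (0 : ℝ) 1) : 0 ≤ tilt l x :=
  add_nonneg (mul_nonneg (by linarith [hl.2]) hx.1) (mul_nonneg hl.1 (by linarith [hx.2]))

theorem tilt_pos_of_mem_Ioo_right (hl : l ∈ Icc (0 : ℝ) 1) (hx : x ∈ Ioo (0 : ℝ) 1) :
    0 < tilt l x := by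
  have h1 : 0 < 1 - x := by linarith [hx.2]
  have h2 : 0 ≤ 1 - l := by linarith [hl.2]
  rcases eq_or_lt_of_le hl.1 with rfl | h0
  · simpa [tilt] using hx.1
  · exact add_pos_of_nonneg_of_pos (mul_nonneg h2 hx.1.le) (mul_pos h0 h1)

theorem tilt_pos_of_mem_Ioo_left (hl : l ∈ Ioo (0 : ℝ) 1) (hx : x ∈ Icc (0 : ℝ) 1) :
    0 < tilt l x := by
  have h1 : 0 ≤ 1 - x := by linarith [hx.2]
  have h2 : 0 < 1 - l := by linarith [hl.2]
  rcases eq_or_lt_of_le hx.1 with rfl | h0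
  · simpa [tilt] using hl.1
  · exact add_pos_of_pos_of_nonneg (mul_pos h2 h0) (mul_nonneg hl.1.le h1)

theorem tiltMap_zero (l : ℝ) : tiltMap l 0 = 0 := by simp [tiltMap]

theorem tiltMap_one (l : ℝ) : tiltMap l 1 = 1 := by simp [tiltMap]

theorem tiltMap_eq (hl : l < 1) (x : ℝ) : tiltMap l x = (1 - l) * x / tilt l x := by
  unfold tiltMap
  split_ifs with h
  · subst h
    have : 1 - l ≠ 0 := by linarith
    simp [tilt, this]
  · rfl

theorem tiltMap_half (x : ℝ) : tiltMap (1 / 2) x = x := by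
  rw [tiltMap_eq (by norm_num)]
  have : tilt (1 / 2) x = 1 / 2 := by unfold tilt; ring
  rw [this]
  ring

theorem tiltMap_le_tiltMap (hl : l ∈ Icc (0 : ℝ) 1) (hx : 0 ≤ x) (hxx : x ≤ x') (hx' : x' ≤ 1) :
    tiltMap l x ≤ tiltMap l x' := by
  have hl0 := hl.1
  have hl1 := hl.2
  rcases eq_or_lt_of_le hxx with rfl | hlt
  · exact le_rfl
  rcases eq_or_lt_of_le hx with rfl | hx0
  · rw [tiltMap_zero]
    unfold tiltMap
    split_ifs
    · exact zero_le_one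
    · exact div_nonneg (mul_nonneg (by linarith) hxx) (tilt_nonneg hl ⟨hxx, hx'⟩)
  have h1 := tilt_pos_of_mem_Ioo_right hl ⟨hx0, hlt.trans_le hx'⟩
  rcases eq_or_lt_of_le hx' with rfl | hx1
  · rw [tiltMap_one, tiltMap, if_neg hlt.ne, div_le_one h1, tilt]
    nlinarith
  · have h2 := tilt_pos_of_mem_Ioo_right hl ⟨hx0.trans hlt, hx1⟩
    rw [tiltMap, tiltMap, if_neg (hlt.trans hx1).ne, if_neg hx1.ne, div_le_div_iff₀ h1 h2]
    have : (1 - l) * x' * tilt l x - (1 - l) * x * tilt l x' = (1 - l) * l * (x' - x) := by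
      unfold tilt; ring
    have : 0 ≤ (1 - l) * l * (x' - x) :=
      mul_nonneg (mul_nonneg (by linarith) hl0) (by linarith)
    linarith

theorem continuousOn_tiltMap (hx : x ∈ Icc (0 : ℝ) 1) :
    ContinuousOn (fun l => tiltMap l x) (Icc 0 1) := by
  rcases eq_or_lt_of_le hx.2 with rfl | h1
  · simp only [tiltMap_one]; exact continuousOn_const
  rcases eq_or_lt_of_le hx.1 with rfl | h0
  · simp only [tiltMap_zero]; exact continuousOn_const
  simp only [tiltMap, if_neg h1.ne]
  refine ContinuousOn.div (by fun_prop) ?_ fun l hl =>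
    (tilt_pos_of_mem_Ioo_right hl ⟨h0, h1⟩).ne'
  unfold tilt
  fun_prop

theorem tiltMap_injOn (hx : x ∈ Ioo (0 : ℝ) 1) : InjOn (fun l => tiltMap l x) (Icc 0 1) := by
  intro l hl l' hl' h
  have h1 := tilt_pos_of_mem_Ioo_right hl hx
  have h2 := tilt_pos_of_mem_Ioo_right hl' hx
  simp only [tiltMap, if_neg hx.2.ne] at h
  rw [div_eq_div_iff h1.ne' h2.ne'] at h
  have hx0 := hx.1
  have hx1 := hx.2
  have : (x * (1 - x)) * l = (x * (1 - x)) * l' := by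
    unfold tilt at h
    linear_combination -h
  exact mul_left_cancel₀ (mul_pos hx0 (by linarith)).ne' this

namespace IsLFData

theorem b_mem (h : IsLFData a b c) (i : Fin N) : b i ∈ Icc (0 : ℝ) 1 :=
  ⟨h.b_nonneg i, (h.b_lt_one i).le⟩

theorem end_mem (h : IsLFData a b c) (i : Fin N) : lfEnd a b c i ∈ Icc (0 : ℝ) 1 :=
  ⟨(h.end_pos i).le, h.end_le i⟩

theorem tiltProb_nonneg (h : IsLFData a b c) (i : Fin N) (hl : l ∈ Icc (0 : ℝ) 1) :
    0 ≤ tiltProb a b c i l :=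
  sub_nonneg.2 (tiltMap_le_tiltMap hl (h.b_nonneg i) (h.b_lt i).le (h.end_le i))

theorem sum_tiltProb (h : IsLFData a b c) (hN : 0 < N) (l : ℝ) :
    ∑ i, tiltProb a b c i l = 1 := by
  have := h.sum_sub hN (tiltMap l)
  rwa [tiltMap_zero, tiltMap_one, sub_zero] at this

theorem tiltNext_den_pos (h : IsLFData a b c) (i : Fin N) (hl : l ∈ Icc (0 : ℝ) 1) :
    0 < tilt l (b i) + (c i + 1) * tilt l (lfEnd a b c i) := by
  have h1 := tilt_nonneg hl (h.b_mem i)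
  have h2 := tilt_nonneg hl (h.end_mem i)
  have hc := h.c_pos i
  rcases eq_or_lt_of_le hl.1 with rfl | h0
  · have : 0 < tilt 0 (lfEnd a b c i) := by simpa [tilt] using h.end_pos i
    positivity
  · have : 0 < tilt l (b i) := by
      have := h.b_lt_one i
      have := h.b_nonneg i
      have := hl.2
      unfold tilt
      nlinarith
    positivity

theorem tiltNext_mem (h : IsLFData a b c) (i : Fin N) (hl : l ∈ Icc (0 : ℝ) 1) :
    tiltNext a b c i l ∈ Icc (0 : ℝ) 1 := by
  have h1 := tilt_nonneg hl (h.b_mem i)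
  have h2 := mul_nonneg (h.c_pos i).le (tilt_nonneg hl (h.end_mem i))
  have h3 := h.tiltNext_den_pos i hl
  exact ⟨div_nonneg h1 h3.le, (div_le_one h3).2 (by linarith)⟩

theorem tiltNext_mem_Ioo (h : IsLFData a b c) (i : Fin N) (hl : l ∈ Ioo (0 : ℝ) 1) :
    tiltNext a b c i l ∈ Ioo (0 : ℝ) 1 := by
  have h1 := tilt_pos_of_mem_Ioo_left hl (h.b_mem i)
  have h2 := mul_pos (h.c_pos i) (tilt_pos_of_mem_Ioo_left hl (h.end_mem i))
  have h3 := add_pos h1 h2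
  exact ⟨div_pos h1 h3, (div_lt_one h3).2 (by linarith)⟩

theorem continuousOn_tiltProb (h : IsLFData a b c) (i : Fin N) :
    ContinuousOn (tiltProb a b c i) (Icc 0 1) :=
  (continuousOn_tiltMap (h.end_mem i)).sub (continuousOn_tiltMap (h.b_mem i))

theorem continuousOn_tiltNext (h : IsLFData a b c) (i : Fin N) :
    ContinuousOn (tiltNext a b c i) (Icc 0 1) := by
  refine ContinuousOn.div ?_ ?_ fun l hl => (h.tiltNext_den_pos i hl).ne' <;>
  · unfold tilt
    fun_prop

/-- The cocycle identity: seen through the chart `tiltMap l`, the map `g_i` is an affine copy, of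
length `tiltProb a b c i l`, of the chart with parameter `tiltNext a b c i l`. -/
theorem tiltMap_lf (h : IsLFData a b c) (i : Fin N) (hl : l ∈ Ioo (0 : ℝ) 1)
    (hx : x ∈ Icc (0 : ℝ) 1) :
    tiltMap l ((a i * x + b i) / (c i * x + 1)) =
      tiltMap l (b i) + tiltProb a b c i l * tiltMap (tiltNext a b c i l) x := by
  have hm := h.end_mul i
  have hc := h.c_pos i
  have h1 := tilt_pos_of_mem_Ioo_left hl (h.b_mem i)
  have h2 := tilt_pos_of_mem_Ioo_left hl (h.end_mem i)
  have hn := h.tiltNext_mem_Ioo i hl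
  have hden : 0 < c i * x + 1 := by
    rcases eq_or_lt_of_le hx.2 with rfl | hlt
    · linarith
    · nlinarith [mul_nonneg hx.1 hc.le]
  have ha : a i = lfEnd a b c i * (c i + 1) - b i := by linarith
  rw [tiltProb, tiltMap_eq hl.2, tiltMap_eq hl.2, tiltMap_eq hl.2, tiltMap_eq hn.2]
  have hS := h.tiltNext_den_pos i ⟨hl.1.le, hl.2.le⟩
  set e := lfEnd a b c i
  set s := tilt l (b i) with hs
  set t := tilt l e with ht
  have hpos : 0 < (c i + 1) * t * x + s * (1 - x) := by
    rcases eq_or_lt_of_le hx.1 with rfl | h0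
    · linarith
    · have : 0 ≤ s * (1 - x) := mul_nonneg h1.le (by linarith [hx.2])
      have : 0 < (c i + 1) * t * x := by positivity
      linarith
  have e1 : tilt l ((a i * x + b i) / (c i * x + 1)) =
      ((c i + 1) * t * x + s * (1 - x)) / (c i * x + 1) := by
    rw [hs, ht, ha]
    unfold tilt
    field_simp
    ring
  have e2 : 1 - tiltNext a b c i l = (c i + 1) * t / (s + (c i + 1) * t) := by
    rw [tiltNext, eq_div_iff hS.ne', sub_mul, div_mul_cancel₀ _ hS.ne']
    ring
  have e3 : tilt (tiltNext a b c i l) x =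
      ((c i + 1) * t * x + s * (1 - x)) / (s + (c i + 1) * t) := by
    rw [tilt, e2, tiltNext]
    ring
  rw [e1, e2, e3, ha]
  obtain ⟨D, hD⟩ : ∃ D, D = (c i + 1) * t * x + s * (1 - x) := ⟨_, rfl⟩
  rw [← hD] at hpos ⊢
  field_simp
  rw [hD]
  ring

/-- A parameter `l ∈ (0,1)` fixed by `tiltNext` gives the fixed point `y = (1 - 2 l) / l` of
`H_i`. -/
theorem quadratic_of_tiltNext_eq (h : IsLFData a b c) (i : Fin N) (hl : l ∈ Ioo (0 : ℝ) 1)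
    (hfix : tiltNext a b c i l = l) :
    b i * ((1 - 2 * l) / l) ^ 2 + (1 - a i) * ((1 - 2 * l) / l) - c i = 0 := by
  have hS := h.tiltNext_den_pos i ⟨hl.1.le, hl.2.le⟩
  have hm := h.end_mul i
  have h0 := hl.1
  rw [tiltNext, div_eq_iff hS.ne'] at hfix
  unfold tilt at hfix
  field_simp
  linear_combination hfix + (l - 2*l^2) * hm

end IsLFData

end Tilt

/-! ### The gap in the Bhattacharyya coefficient -/

section Gap

variable {N : ℕ} {a b c : Fin N → ℝ}

/-- The Bhattacharyya coefficient `∑ √(p_i r_i)` of a probability vector and a subprobability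
vector is at most `1`. -/
theorem sum_sqrt_mul_le_one {ι : Type*} [Fintype ι] {p r : ι → ℝ} (hp : ∀ i, 0 ≤ p i)
    (hr : ∀ i, 0 ≤ r i) (hps : ∑ i, p i = 1) (hrs : ∑ i, r i ≤ 1) :
    ∑ i, √(p i * r i) ≤ 1 := by
  have h1 : ∀ i, √(p i * r i) ≤ (p i + r i) / 2 := fun i => by
    rw [Real.sqrt_mul (hp i)]
    nlinarith [sq_nonneg (√(p i) - √(r i)), Real.sq_sqrt (hp i), Real.sq_sqrt (hr i)]
  calc ∑ i, √(p i * r i) ≤ ∑ i, (p i + r i) / 2 := Finset.sum_le_sum fun i _ => h1 i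
    _ = (∑ i, p i + ∑ i, r i) / 2 := by rw [← Finset.sum_add_distrib, Finset.sum_div]
    _ ≤ 1 := by linarith

theorem eq_of_one_le_sum_sqrt_mul {ι : Type*} [Fintype ι] {p r : ι → ℝ} (hp : ∀ i, 0 ≤ p i)
    (hr : ∀ i, 0 ≤ r i) (hps : ∑ i, p i = 1) (hrs : ∑ i, r i ≤ 1)
    (h : 1 ≤ ∑ i, √(p i * r i)) : p = r := by
  have h1 : ∀ i, √(p i * r i) = (p i + r i) / 2 - (√(p i) - √(r i)) ^ 2 / 2 := fun i => by
    rw [Real.sqrt_mul (hp i), sub_sq, Real.sq_sqrt (hp i), Real.sq_sqrt (hr i)]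
    ring
  simp_rw [h1] at h
  rw [Finset.sum_sub_distrib, ← Finset.sum_div, Finset.sum_add_distrib, ← Finset.sum_div] at h
  have h2 : ∑ i, (√(p i) - √(r i)) ^ 2 = 0 :=
    le_antisymm (by linarith) (Finset.sum_nonneg fun i _ => sq_nonneg _)
  rw [Finset.sum_eq_zero_iff_of_nonneg fun i _ => sq_nonneg _] at h2
  funext i
  have h3 := h2 i (Finset.mem_univ i)
  have h4 : √(p i) = √(r i) := by
    have := pow_eq_zero_iff (two_ne_zero) |>.1 h3
    linarith
  exact (Real.sqrt_inj (hp i) (hr i)).1 h4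

/-- The Bhattacharyya coefficient over two steps of the Markov chain started at `l` against the
Bernoulli weights `r`. -/
noncomputable def twoStep (a b c : Fin N → ℝ) (l : ℝ) (r : Fin N → ℝ) : ℝ :=
  ∑ i, √(tiltProb a b c i l * r i) *
    ∑ j, √(tiltProb a b c j (tiltNext a b c i l) * r j)

theorem IsLFData.twoStep_lt_one (h : IsLFData a b c) (hN : 2 ≤ N)
    (hfix : ¬ ∃ y : ℝ, -1 < y ∧ ∀ i, b i * y ^ 2 + (1 - a i) * y - c i = 0)
    {l : ℝ} (hl : l ∈ Icc (0 : ℝ) 1) {r : Fin N → ℝ} (hr : ∀ i, 0 < r i) (hrs : ∑ i, r i ≤ 1) :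
    twoStep a b c l r < 1 := by
  have hs : ∀ l ∈ Icc (0 : ℝ) 1, ∑ j, √(tiltProb a b c j l * r j) ≤ 1 := fun l hl =>
    sum_sqrt_mul_le_one (fun i => h.tiltProb_nonneg i hl) (fun i => (hr i).le)
      (h.sum_tiltProb (by omega) l) hrs
  have heq : ∀ l ∈ Icc (0 : ℝ) 1, 1 ≤ ∑ j, √(tiltProb a b c j l * r j) →
      (fun j => tiltProb a b c j l) = r := fun l hl =>
    eq_of_one_le_sum_sqrt_mul (fun i => h.tiltProb_nonneg i hl) (fun i => (hr i).le)
      (h.sum_tiltProb (by omega) l) hrs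
  have hle : ∀ i, √(tiltProb a b c i l * r i) *
      ∑ j, √(tiltProb a b c j (tiltNext a b c i l) * r j) ≤ √(tiltProb a b c i l * r i) :=
    fun i => mul_le_of_le_one_right (Real.sqrt_nonneg _) (hs _ (h.tiltNext_mem i hl))
  by_contra! hge
  have h1 := heq l hl (hge.trans (Finset.sum_le_sum fun i _ => hle i))
  have h2 : ∀ i, (fun j => tiltProb a b c j (tiltNext a b c i l)) = r := by
    intro i
    apply heq _ (h.tiltNext_mem i hl)
    by_contra! hlt
    have : twoStep a b c l r < ∑ i, √(tiltProb a b c i l * r i) := by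
      refine Finset.sum_lt_sum (fun i _ => hle i) ⟨i, Finset.mem_univ i, ?_⟩
      refine mul_lt_of_lt_one_right (Real.sqrt_pos.2 ?_) hlt
      rw [show tiltProb a b c i l = r i from congrFun h1 i]
      exact mul_pos (hr i) (hr i)
    linarith [hs l hl]
  -- the first entry of the probability vector already determines the parameter
  let i₀ : Fin N := ⟨0, by omega⟩
  have hmem : lfEnd a b c i₀ ∈ Ioo (0 : ℝ) 1 :=
    ⟨h.end_pos i₀, h.end_lt_one (by simp [i₀]; omega)⟩
  have hp0 : ∀ l, tiltProb a b c i₀ l = tiltMap l (lfEnd a b c i₀) := fun l => by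
    rw [tiltProb, h.first i₀ rfl, tiltMap_zero, sub_zero]
  have h3 : ∀ i, tiltNext a b c i l = l := by
    intro i
    refine tiltMap_injOn hmem (h.tiltNext_mem i hl) hl ?_
    simp only
    rw [← hp0, ← hp0]
    exact (congrFun (h2 i) i₀).trans (congrFun h1 i₀).symm
  have hl0 : l ≠ 0 := by
    rintro rfl
    have e1 : tiltProb a b c i₀ 0 = 1 := by
      rw [hp0, tiltMap_eq one_pos]
      simp [tilt, hmem.1.ne']
    have e2 := congrFun h1 i₀
    let i₁ : Fin N := ⟨1, by omega⟩
    have : r i₀ + r i₁ ≤ ∑ i, r i :=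
      Finset.add_le_sum (fun i _ => (hr i).le) (Finset.mem_univ _) (Finset.mem_univ _)
        (by simp [i₀, i₁])
    have := hr i₁
    simp only [e1] at e2
    linarith
  have hl1 : l ≠ 1 := by
    rintro rfl
    have e1 : tiltProb a b c i₀ 1 = 0 := by
      rw [hp0, tiltMap, if_neg hmem.2.ne]
      simp
    have e2 := congrFun h1 i₀
    simp only [e1] at e2
    linarith [hr i₀]
  have hl' : l ∈ Ioo (0 : ℝ) 1 := ⟨lt_of_le_of_ne hl.1 hl0.symm, lt_of_le_of_ne hl.2 hl1⟩
  refine hfix ⟨(1 - 2 * l) / l, ?_, fun i => h.quadratic_of_tiltNext_eq i hl' (h3 i)⟩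
  rw [lt_div_iff₀ hl'.1]
  linarith [hl'.2]

/-- By compactness of the set of parameters the two-step coefficient is bounded away from `1`. -/
theorem IsLFData.exists_twoStep_le (h : IsLFData a b c) (hN : 2 ≤ N)
    (hfix : ¬ ∃ y : ℝ, -1 < y ∧ ∀ i, b i * y ^ 2 + (1 - a i) * y - c i = 0)
    {ε : ℝ} (hε : 0 < ε) :
    ∃ ρ : ℝ, ρ < 1 ∧ ∀ l ∈ Icc (0 : ℝ) 1, ∀ r : Fin N → ℝ, (∀ i, ε ≤ r i) → ∑ i, r i ≤ 1 →
      twoStep a b c l r ≤ ρ := by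
  let R : Set (Fin N → ℝ) := Set.pi univ (fun _ => Icc ε 1) ∩ {r | ∑ i, r i ≤ 1}
  have hR : IsCompact R :=
    (isCompact_univ_pi fun _ => isCompact_Icc).inter_right
      (isClosed_le (by fun_prop) continuous_const)
  have hK : IsCompact (Icc (0 : ℝ) 1 ×ˢ R) := isCompact_Icc.prod hR
  have hcont : ContinuousOn (fun q : ℝ × (Fin N → ℝ) => twoStep a b c q.1 q.2)
      (Icc (0 : ℝ) 1 ×ˢ R) := by
    have hfst : MapsTo (fun q : ℝ × (Fin N → ℝ) => q.1) (Icc (0 : ℝ) 1 ×ˢ R) (Icc 0 1) :=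
      fun q hq => hq.1
    have hr : ∀ j, ContinuousOn (fun q : ℝ × (Fin N → ℝ) => q.2 j) (Icc (0 : ℝ) 1 ×ˢ R) :=
      fun j => by fun_prop
    unfold twoStep
    refine continuousOn_finsetSum _ fun i _ => ContinuousOn.mul ?_
      (continuousOn_finsetSum _ fun j _ => ?_)
    · exact (((h.continuousOn_tiltProb i).comp continuousOn_fst hfst).mul (hr i)).sqrt
    · exact (((h.continuousOn_tiltProb j).comp
        ((h.continuousOn_tiltNext i).comp continuousOn_fst hfst)
        fun q hq => h.tiltNext_mem i hq.1).mul (hr j)).sqrt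
  have hmem : ∀ r : Fin N → ℝ, (∀ i, ε ≤ r i) → ∑ i, r i ≤ 1 → r ∈ R := by
    intro r hr hrs
    refine ⟨fun i _ => ⟨hr i, le_trans ?_ hrs⟩, hrs⟩
    exact Finset.single_le_sum (fun j _ => hε.le.trans (hr j)) (Finset.mem_univ i)
  rcases (Icc (0 : ℝ) 1 ×ˢ R).eq_empty_or_nonempty with he | hne
  · refine ⟨0, one_pos, fun l hl r hr hrs => ?_⟩
    have : (l, r) ∈ Icc (0 : ℝ) 1 ×ˢ R := ⟨hl, hmem r hr hrs⟩
    rw [he] at this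
    exact this.elim
  · obtain ⟨q, hq, hmax⟩ := hK.exists_isMaxOn hne hcont
    refine ⟨twoStep a b c q.1 q.2, ?_, fun l hl r hr hrs => ?_⟩
    · exact h.twoStep_lt_one hN hfix hq.1
        (fun i => hε.trans_le (hq.2.1 i (mem_univ i)).1) hq.2.2
    · exact isMaxOn_iff.1 hmax (l, r) ⟨hl, hmem r hr hrs⟩

end Gap

/-! ### Words and the Markov process -/

section Words

/-- The composition `f_{w 0} ∘ ⋯ ∘ f_{w (n - 1)}` along a word `w` of length `n`. -/
def wordMap {ι α : Type*} (f : ι → α → α) : (n : ℕ) → (Fin n → ι) → α → α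
  | 0, _ => id
  | n + 1, w => f (w 0) ∘ wordMap f n (Fin.tail w)

/-- The probability that the Markov process, which in the state `l` emits the letter `i` with
probability `p i l` and then jumps to the state `H i l`, emits the word `w` from the state `l`. -/
def wordProb {ι S : Type*} (p : ι → S → ℝ) (H : ι → S → S) : (n : ℕ) → (Fin n → ι) → S → ℝ
  | 0, _, _ => 1
  | n + 1, w, l => p (w 0) l * wordProb p H n (Fin.tail w) (H (w 0) l)

theorem sum_word_succ {ι M : Type*} [Fintype ι] [AddCommMonoid M] {n : ℕ}
    (F : ι → (Fin n → ι) → M) :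
    ∑ w : Fin (n + 1) → ι, F (w 0) (Fin.tail w) = ∑ i, ∑ w, F i w := by
  rw [← Fintype.sum_prod_type', ← (Fin.consEquiv fun _ => ι).sum_comp]
  simp [Fin.consEquiv]

theorem prod_word_succ {ι M : Type*} [CommMonoid M] {n : ℕ} (q : ι → M) (w : Fin (n + 1) → ι) :
    ∏ k, q (w k) = q (w 0) * ∏ k, q (Fin.tail w k) :=
  Fin.prod_univ_succ _

theorem wordMap_conj {ι α β : Type*} {f : ι → α → α} {g : ι → β → β} {φ : α → β}
    (h : ∀ i, g i ∘ φ = φ ∘ f i) (n : ℕ) (w : Fin n → ι) (x : α) :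
    φ (wordMap f n w x) = wordMap g n w (φ x) := by
  induction n with
  | zero => rfl
  | succ n ih =>
    have := congrFun (h (w 0)) (wordMap f n (Fin.tail w) x)
    simp only [Function.comp_apply] at this
    simp only [wordMap, Function.comp_apply, ← this, ih]

theorem wordMap_monotone {ι α : Type*} [Preorder α] {f : ι → α → α} (h : ∀ i, Monotone (f i))
    (n : ℕ) (w : Fin n → ι) : Monotone (wordMap f n w) := by
  induction n with
  | zero => exact monotone_id
  | succ n ih => exact (h _).comp (ih _)

theorem exists_wordMap_eq {ι α : Type*} {f : ι → α → α} (h : ∀ x, ∃ i y, f i y = x) (n : ℕ)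
    (x : α) : ∃ (w : Fin n → ι) (y : α), wordMap f n w y = x := by
  induction n generalizing x with
  | zero => exact ⟨Fin.elim0, x, rfl⟩
  | succ n ih =>
    obtain ⟨i, y, rfl⟩ := h x
    obtain ⟨w, z, rfl⟩ := ih y
    exact ⟨Fin.cons i w, z, by simp [wordMap]⟩

theorem dist_wordMap_le {ι α : Type*} [PseudoMetricSpace α] {f : ι → α → α} {r : ι → ℝ}
    (hr : ∀ i, 0 ≤ r i) (h : ∀ i x y, dist (f i x) (f i y) ≤ r i * dist x y) (n : ℕ)
    (w : Fin n → ι) (x y : α) :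
    dist (wordMap f n w x) (wordMap f n w y) ≤ (∏ k, r (w k)) * dist x y := by
  induction n with
  | zero => simp [wordMap]
  | succ n ih =>
    rw [prod_word_succ, mul_assoc]
    exact (h _ _ _).trans (mul_le_mul_of_nonneg_left (ih _) (hr _))

section Prob

variable {ι S : Type*} {p : ι → S → ℝ} {H : ι → S → S} {T : Set S}

theorem wordProb_nonneg (hT : ∀ i, ∀ l ∈ T, H i l ∈ T) (hp : ∀ i, ∀ l ∈ T, 0 ≤ p i l)
    (n : ℕ) (w : Fin n → ι) {l : S} (hl : l ∈ T) : 0 ≤ wordProb p H n w l := by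
  induction n generalizing l with
  | zero => exact zero_le_one
  | succ n ih => exact mul_nonneg (hp _ l hl) (ih _ (hT _ l hl))

theorem sum_wordProb [Fintype ι] (hp : ∀ l, ∑ i, p i l = 1) (n : ℕ) (l : S) :
    ∑ w, wordProb p H n w l = 1 := by
  induction n generalizing l with
  | zero => simp [wordProb]
  | succ n ih =>
    simp only [wordProb]
    rw [sum_word_succ (fun i w => p i l * wordProb p H n w (H i l))]
    simp_rw [← Finset.mul_sum, ih, mul_one, hp]

theorem sum_sqrt_wordProb_succ [Fintype ι]
    (hp : ∀ i, ∀ l ∈ T, 0 ≤ p i l) {q : ι → ℝ} (hq : ∀ i, 0 ≤ q i) (n : ℕ) {l : S} (hl : l ∈ T) :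
    ∑ w, √(wordProb p H (n + 1) w l * ∏ k, q (w k)) =
      ∑ i, √(p i l * q i) * ∑ w, √(wordProb p H n w (H i l) * ∏ k, q (w k)) := by
  simp_rw [Finset.mul_sum]
  rw [← sum_word_succ (fun i w =>
    √(p i l * q i) * √(wordProb p H n w (H i l) * ∏ k, q (w k)))]
  refine Finset.sum_congr rfl fun w _ => ?_
  rw [← Real.sqrt_mul (mul_nonneg (hp _ l hl) (hq _)), prod_word_succ, wordProb]
  congr 1
  ring

/-- If two steps of the process contract the Bhattacharyya coefficient by the factor `κ`, then it
decays like `κ ^ n` along words of length `2 n`. -/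
theorem sum_sqrt_wordProb_le [Fintype ι] (hT : ∀ i, ∀ l ∈ T, H i l ∈ T)
    (hp : ∀ i, ∀ l ∈ T, 0 ≤ p i l) {q : ι → ℝ} (hq : ∀ i, 0 ≤ q i) {κ : ℝ} (hκ : 0 ≤ κ)
    (h : ∀ l ∈ T, ∑ i, √(p i l * q i) * ∑ j, √(p j (H i l) * q j) ≤ κ)
    (n : ℕ) {l : S} (hl : l ∈ T) :
    ∑ w, √(wordProb p H (2 * n) w l * ∏ k, q (w k)) ≤ κ ^ n := by
  induction n generalizing l with
  | zero => simp [wordProb]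
  | succ n ih =>
    rw [show 2 * (n + 1) = 2 * n + 1 + 1 by ring, sum_sqrt_wordProb_succ hp hq _ hl]
    calc _ ≤ ∑ i, √(p i l * q i) * ((∑ j, √(p j (H i l) * q j)) * κ ^ n) := by
          refine Finset.sum_le_sum fun i _ =>
            mul_le_mul_of_nonneg_left ?_ (Real.sqrt_nonneg _)
          rw [sum_sqrt_wordProb_succ hp hq _ (hT i l hl), Finset.sum_mul]
          exact Finset.sum_le_sum fun j _ =>
            mul_le_mul_of_nonneg_left (ih (hT j _ (hT i l hl))) (Real.sqrt_nonneg _)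
      _ = (∑ i, √(p i l * q i) * ∑ j, √(p j (H i l) * q j)) * κ ^ n := by
          rw [Finset.sum_mul]
          simp_rw [mul_assoc]
      _ ≤ κ ^ (n + 1) := by
          rw [pow_succ']
          exact mul_le_mul_of_nonneg_right (h l hl) (pow_nonneg hκ n)

end Prob

end Words

/-- The image under the chart `tiltMap l` of the cylinder of the word `w` has length
`wordProb … w l`. -/
theorem IsLFSystem.tiltMap_wordMap_sub {N : ℕ} {g : Fin N → I → I} {a b c d : Fin N → ℝ}
    (hg : IsLFSystem g a b c d) (hd : ∀ i, d i = 1) (n : ℕ) (w : Fin n → Fin N) {l : ℝ}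
    (hl : l ∈ Ioo (0 : ℝ) 1) :
    tiltMap l (wordMap g n w 1 : I) - tiltMap l (wordMap g n w 0 : I) =
      wordProb (tiltProb a b c) (tiltNext a b c) n w l := by
  have h := hg.isLFData hd
  induction n generalizing l with
  | zero => simp [wordMap, wordProb, tiltMap_zero, tiltMap_one]
  | succ n ih =>
    simp only [wordMap, wordProb, Function.comp_apply, hg.apply_eq hd]
    rw [h.tiltMap_lf _ hl (wordMap g n _ 1).2, h.tiltMap_lf _ hl (wordMap g n _ 0).2,
      ← ih (Fin.tail w) (h.tiltNext_mem_Ioo _ hl)]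
    ring

theorem IsLFSystem.wordMap_sub {N : ℕ} {g : Fin N → I → I} {a b c d : Fin N → ℝ}
    (hg : IsLFSystem g a b c d) (hd : ∀ i, d i = 1) (n : ℕ) (w : Fin n → Fin N) :
    ((wordMap g n w 1 : I) : ℝ) - (wordMap g n w 0 : I) =
      wordProb (tiltProb a b c) (tiltNext a b c) n w (1 / 2) := by
  rw [← hg.tiltMap_wordMap_sub hd n w (by norm_num), tiltMap_half, tiltMap_half]

/-! ### Compatible and contractive systems -/

section Systems

variable {N : ℕ}

/-- The images of the maps of a compatible system cover `[0,1]`. -/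
theorem IsCompatibleSystem.exists_eq {f : Fin N → I → I} (hf : IsCompatibleSystem f) (hN : 0 < N)
    (x : I) : ∃ i y, f i y = x := by
  -- the largest index whose interval starts at or to the left of `x`
  let s : Finset (Fin N) := Finset.univ.filter fun i => f i 0 ≤ x
  have hs : s.Nonempty :=
    ⟨⟨0, hN⟩, by simp [s, hf.first ⟨0, hN⟩ rfl]⟩
  set i := s.max' hs with hi
  have hi0 : f i 0 ≤ x := (Finset.mem_filter.1 (s.max'_mem hs)).2
  have hi1 : x ≤ f i 1 := by
    by_cases hlast : (i : ℕ) + 1 = N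
    · rw [hf.last i hlast]
      exact unitInterval.le_one'
    · by_contra! hlt
      let j : Fin N := ⟨i + 1, by omega⟩
      have hj : j ∈ s := by
        simp only [s, Finset.mem_filter, Finset.mem_univ, true_and]
        rw [← hf.step i j rfl]
        exact hlt.le
      have h1 : j ≤ i := s.le_max' j hj
      have h2 : (j : ℕ) ≤ i := h1
      simp [j] at h2
  obtain ⟨y, -, hy⟩ := intermediate_value_Icc (zero_le_one (α := I))
    (hf.continuous i).continuousOn ⟨hi0, hi1⟩
  exact ⟨i, y, hy⟩

theorem dist_le_of_lipConst_ne_top {h : I → I} (hh : lipConst h ≠ ∞) (x y : I) :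
    dist (h x) (h y) ≤ (lipConst h).toReal * dist x y := by
  rcases eq_or_ne x y with rfl | hxy
  · simp
  have h1 : ENNReal.ofReal (|(h x : ℝ) - h y| / |(x : ℝ) - y|) ≤ lipConst h :=
    le_iSup_of_le x (le_iSup_of_le y (le_iSup_of_le hxy le_rfl))
  have h2 : 0 < |(x : ℝ) - y| := abs_pos.2 (sub_ne_zero.2 fun h => hxy (Subtype.ext h))
  have h3 := (ENNReal.ofReal_le_iff_le_toReal hh).1 h1
  rwa [div_le_iff₀ h2] at h3

end Systems

/-! ### Upper bound for the dimension of a measure -/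

section Dimension

open Filter Topology

/-- An upper bound for the dimension of a measure on `[0,1]`. Let the finite families `J n` cover
`[0,1]`, with masses at most `m n w` and diameters at most `ρ n w`. If `∑ √(m (ρ ^ s))` decays
exponentially, then by the Borel–Cantelli lemma almost every point is eventually covered only by
sets with `ρ ^ s ≤ m`, and these form economical covers. -/
theorem dimHMeasure_le_of_sum_sqrt_le {μ : Measure ℝ} (hμ : μ (Icc 0 1) = 1)
    {W : ℕ → Type*} [∀ n, Fintype (W n)] {J : ∀ n, W n → Set ℝ} {m ρ : ∀ n, W n → ℝ}
    {s κ : ℝ} {η : ℕ → ℝ} (hs : 0 < s) (hκ0 : 0 ≤ κ) (hκ : κ < 1)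
    (hJ : ∀ n w, MeasurableSet (J n w)) (hcov : ∀ n, Icc 0 1 ⊆ ⋃ w, J n w)
    (hm : ∀ n w, 0 ≤ m n w) (hμJ : ∀ n w, μ (J n w) ≤ ENNReal.ofReal (m n w))
    (hm1 : ∀ n, ∑ w, m n w ≤ 1) (hρ : ∀ n w, 0 ≤ ρ n w)
    (hdiam : ∀ n w, Metric.ediam (J n w) ≤ ENNReal.ofReal (ρ n w)) (hη : ∀ n w, ρ n w ≤ η n)
    (hη0 : Tendsto η atTop (𝓝 0)) (hsum : ∀ n, ∑ w, √(m n w * ρ n w ^ s) ≤ κ ^ n) :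
    dimHMeasure μ ≤ ENNReal.ofReal s := by
  classical
  let B : ℕ → Set ℝ := fun n => ⋃ w ∈ Finset.univ.filter (fun w => m n w < ρ n w ^ s), J n w
  have hBmeas : ∀ n, MeasurableSet (B n) := fun n =>
    Finset.measurableSet_biUnion _ fun w _ => hJ n w
  have hμB : ∀ n, μ (B n) ≤ ENNReal.ofReal (κ ^ n) := by
    intro n
    calc μ (B n) ≤ ∑ w ∈ Finset.univ.filter (fun w => m n w < ρ n w ^ s), μ (J n w) :=
          measure_biUnion_finset_le _ _
      _ ≤ ∑ w ∈ Finset.univ.filter (fun w => m n w < ρ n w ^ s),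
            ENNReal.ofReal (√(m n w * ρ n w ^ s)) := by
          refine Finset.sum_le_sum fun w hw => (hμJ n w).trans (ENNReal.ofReal_le_ofReal ?_)
          apply Real.le_sqrt_of_sq_le
          rw [sq]
          exact mul_le_mul_of_nonneg_left (Finset.mem_filter.1 hw).2.le (hm n w)
      _ ≤ ∑ w, ENNReal.ofReal (√(m n w * ρ n w ^ s)) :=
          Finset.sum_le_sum_of_subset (Finset.filter_subset _ _)
      _ = ENNReal.ofReal (∑ w, √(m n w * ρ n w ^ s)) :=
          (ENNReal.ofReal_sum_of_nonneg fun w _ => Real.sqrt_nonneg _).symm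
      _ ≤ _ := ENNReal.ofReal_le_ofReal (hsum n)
  have hB0 : μ (limsup B atTop) = 0 := by
    apply measure_limsup_atTop_eq_zero
    refine ne_top_of_le_ne_top ?_ (ENNReal.tsum_le_tsum hμB)
    rw [← ENNReal.ofReal_tsum_of_nonneg (fun n => pow_nonneg hκ0 n)
      (summable_geometric_of_lt_one hκ0 hκ)]
    exact ENNReal.ofReal_ne_top
  let A : ℕ → Set ℝ := fun k => {x ∈ Icc (0 : ℝ) 1 | ∀ n ≥ k, x ∉ B n}
  have hsub : Icc 0 1 \ limsup B atTop ⊆ ⋃ k, A k := by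
    rintro x ⟨hx, hxB⟩
    rw [mem_limsup_iff_frequently_mem, not_frequently, eventually_atTop] at hxB
    obtain ⟨k, hk⟩ := hxB
    exact mem_iUnion.2 ⟨k, hx, hk⟩
  have hA : ∀ k, dimH (A k) ≤ ENNReal.ofReal s := by
    intro k
    have h1 : μH[s] (A k) ≤ 1 := by
      let t : ∀ n, W n → Set ℝ := fun n w => if m n w < ρ n w ^ s then ∅ else J n w
      refine (Measure.hausdorffMeasure_le_liminf_sum s (A k) (l := atTop)
        (fun n => ENNReal.ofReal (η n)) ?_ t ?_ ?_).trans ?_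
      · simpa using ENNReal.tendsto_ofReal hη0
      · refine Eventually.of_forall fun n w => ?_
        simp only [t]
        split_ifs
        · simp
        · exact (hdiam n w).trans (ENNReal.ofReal_le_ofReal (hη n w))
      · filter_upwards [eventually_ge_atTop k] with n hn x hx
        obtain ⟨w, hw⟩ := mem_iUnion.1 (hcov n hx.1)
        refine mem_iUnion.2 ⟨w, ?_⟩
        have : ¬ m n w < ρ n w ^ s := fun hlt => hx.2 n hn <|
          mem_biUnion (Finset.mem_filter.2 ⟨Finset.mem_univ w, hlt⟩) hw
        simpa [t, this] using hw
      · refine (liminf_le_liminf (Eventually.of_forall fun n => ?_)).trans_eq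
          (liminf_const (f := (atTop : Filter ℕ)) (1 : ℝ≥0∞))
        calc ∑ w, Metric.ediam (t n w) ^ s ≤ ∑ w, ENNReal.ofReal (m n w) := by
              refine Finset.sum_le_sum fun w _ => ?_
              simp only [t]
              split_ifs with hlt
              · simp [ENNReal.zero_rpow_of_pos hs]
              · calc Metric.ediam (J n w) ^ s ≤ ENNReal.ofReal (ρ n w) ^ s :=
                      ENNReal.rpow_le_rpow (hdiam n w) hs.le
                  _ = ENNReal.ofReal (ρ n w ^ s) :=
                      ENNReal.ofReal_rpow_of_nonneg (hρ n w) hs.le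
                  _ ≤ _ := ENNReal.ofReal_le_ofReal (not_lt.1 hlt)
          _ = ENNReal.ofReal (∑ w, m n w) :=
              (ENNReal.ofReal_sum_of_nonneg fun w _ => hm n w).symm
          _ ≤ 1 := by simpa using hm1 n
    have h2 : μH[(s.toNNReal : ℝ)] (A k) ≠ ∞ := by
      rw [Real.coe_toNNReal s hs.le]
      exact ne_top_of_le_ne_top ENNReal.one_ne_top h1
    exact dimH_le_of_hausdorffMeasure_ne_top h2
  have hmem : dimHMeasure μ ≤ dimH (Icc 0 1 \ limsup B atTop) :=
    iInf_le_of_le _ <| iInf_le_of_le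
      (measurableSet_Icc.diff (MeasurableSet.measurableSet_limsup hBmeas)) <|
      iInf_le_of_le sdiff_subset <| iInf_le_of_le (by rw [measure_sdiff_null hB0, hμ]) le_rfl
  calc dimHMeasure μ ≤ dimH (⋃ k, A k) := hmem.trans (dimH_mono hsub)
    _ ≤ ENNReal.ofReal s := by rw [dimH_iUnion]; exact iSup_le hA

end Dimension

/-! ### The measure with distribution function `φ` -/

section Dist

open Filter Topology

variable {φ : I → I}

theorem continuous_extendReal (hc : Continuous φ) : Continuous (extendReal φ) :=
  (continuous_subtype_val.comp hc).comp continuous_projIcc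

theorem extendReal_coe (φ : I → I) (x : I) : extendReal φ x = φ x :=
  IccExtend_val _ _ x

theorem distMeasure_Icc (hc : Continuous φ) (hm : StrictMono φ) (x y : I) :
    distMeasure φ hc hm (Icc (x : ℝ) y) = ENNReal.ofReal ((φ y : ℝ) - φ x) := by
  rw [distMeasure, StieltjesFunction.measure_Icc]
  change ENNReal.ofReal (extendReal φ y - Function.leftLim (extendReal φ) x) = _
  rw [(continuous_extendReal hc).continuousWithinAt.leftLim_eq, extendReal_coe, extendReal_coe]

theorem isProbabilityMeasure_distMeasure (hc : Continuous φ) (hm : StrictMono φ) (h0 : φ 0 = 0)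
    (h1 : φ 1 = 1) : IsProbabilityMeasure (distMeasure φ hc hm) := by
  apply StieltjesFunction.isProbabilityMeasure
  · refine tendsto_const_nhds.congr' ?_
    filter_upwards [eventually_le_atBot (0 : ℝ)] with x hx
    simp [extendReal, IccExtend_of_le_left _ _ hx, h0]
  · refine tendsto_const_nhds.congr' ?_
    filter_upwards [eventually_ge_atTop (1 : ℝ)] with x hx
    simp [extendReal, IccExtend_of_right_le _ _ hx, h1]

theorem isSingularFunction_of_dimHMeasure_lt_one (hc : Continuous φ) (hm : StrictMono φ)
    (h0 : φ 0 = 0) (h1 : φ 1 = 1) (h : dimHMeasure (distMeasure φ hc hm) < 1) :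
    IsSingularFunction φ := by
  have := isProbabilityMeasure_distMeasure hc hm h0 h1
  simp only [dimHMeasure, iInf_lt_iff] at h
  obtain ⟨A, hA, -, hμA, hdim⟩ := h
  have hvol : volume A = 0 := by
    rw [← hausdorffMeasure_real]
    exact_mod_cast hausdorffMeasure_of_dimH_lt (d := 1) (by exact_mod_cast hdim)
  have hsing : distMeasure φ hc hm ⟂ₘ (volume : Measure ℝ) :=
    ⟨Aᶜ, hA.compl, (prob_compl_eq_zero_iff hA).2 hμA, by rwa [compl_compl]⟩
  refine ⟨hm, hc, ae_restrict_of_ae ?_⟩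
  filter_upwards [StieltjesFunction.ae_hasDerivAt _, hsing.rnDeriv_ae_eq_zero] with x hx hx0
  unfold distMeasure at hx0
  rw [hx0] at hx
  simpa using hx

end Dist

/-! ### Choice of the exponent -/

section Constants

variable {N : ℕ} {a b c : Fin N → ℝ}

theorem twoStep_mono (h : IsLFData a b c) {l : ℝ} (hl : l ∈ Icc (0 : ℝ) 1) {r r' : Fin N → ℝ}
    (hrr : ∀ i, r i ≤ r' i) : twoStep a b c l r ≤ twoStep a b c l r' :=
  Finset.sum_le_sum fun i _ => mul_le_mul
    (Real.sqrt_le_sqrt (mul_le_mul_of_nonneg_left (hrr i) (h.tiltProb_nonneg i hl)))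
    (Finset.sum_le_sum fun j _ => Real.sqrt_le_sqrt
      (mul_le_mul_of_nonneg_left (hrr j) (h.tiltProb_nonneg j (h.tiltNext_mem i hl))))
    (Finset.sum_nonneg fun _ _ => Real.sqrt_nonneg _) (Real.sqrt_nonneg _)

theorem twoStep_smul {C : ℝ} (hC : 0 ≤ C) (l : ℝ) (r : Fin N → ℝ) :
    twoStep a b c l (fun i => C * r i) = C * twoStep a b c l r := by
  have h1 : ∀ p i, √(p * (C * r i)) = √C * √(p * r i) := fun p i => by
    rw [← Real.sqrt_mul hC]
    congr 1
    ring
  simp only [twoStep, h1, ← Finset.mul_sum]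
  rw [Finset.mul_sum]
  refine Finset.sum_congr rfl fun i _ => ?_
  linear_combination √(tiltProb a b c i l * r i) *
    (∑ j, √(tiltProb a b c j (tiltNext a b c i l) * r j)) * Real.mul_self_sqrt hC

/-- For weights `r` with `∑ r_i` close to `1` and an exponent `s < 1` close to `1` the two-step
coefficient against the weights `r_i ^ s` is still bounded away from `1`. -/
theorem IsLFData.exists_twoStep_rpow_le (h : IsLFData a b c) (hN : 2 ≤ N)
    (hfix : ¬ ∃ y : ℝ, -1 < y ∧ ∀ i, b i * y ^ 2 + (1 - a i) * y - c i = 0)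
    {ε : ℝ} (hε : 0 < ε) :
    ∃ δ s κ : ℝ, 0 < δ ∧ 0 < s ∧ s < 1 ∧ 0 ≤ κ ∧ κ < 1 ∧ ∀ l ∈ Icc (0 : ℝ) 1,
      ∀ r : Fin N → ℝ, (∀ i, ε ≤ r i) → ∑ i, r i ≤ 1 + δ →
        twoStep a b c l (fun i => r i ^ s) ≤ κ := by
  obtain ⟨ρ', hρ', hle'⟩ := h.exists_twoStep_le hN hfix (half_pos hε)
  obtain ⟨ρ, hρ0, hρ1, hle⟩ : ∃ ρ : ℝ, 1 / 2 ≤ ρ ∧ ρ < 1 ∧ ∀ l ∈ Icc (0 : ℝ) 1,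
      ∀ r : Fin N → ℝ, (∀ i, ε / 2 ≤ r i) → ∑ i, r i ≤ 1 → twoStep a b c l r ≤ ρ :=
    ⟨max (1 / 2) ρ', le_max_left _ _, max_lt (by norm_num) hρ',
      fun l hl r hr hrs => (hle' l hl r hr hrs).trans (le_max_right _ _)⟩
  -- `δ` is such that `(1 + δ) ρ = (1 + ρ) / 2`
  set δ : ℝ := (1 - ρ) / (2 * ρ) with hδ
  have hδ0 : 0 < δ := div_pos (by linarith) (by linarith)
  have hδ1 : δ ≤ 1 := (div_le_one (by linarith)).2 (by linarith)
  have hδρ : (1 + δ) * ρ = (1 + ρ) / 2 := by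
    rw [hδ]
    field_simp
    ring
  obtain ⟨s, hs0, hs1, hsκ⟩ : ∃ s : ℝ, 0 < s ∧ s < 1 ∧ (1 + ρ) / 2 * ε ^ (s - 1) < 1 := by
    have hcont : ContinuousAt (fun s : ℝ => (1 + ρ) / 2 * ε ^ (s - 1)) 1 := by
      refine continuousAt_const.mul ?_
      exact continuousAt_const.rpow (continuousAt_id.sub continuousAt_const) (Or.inl hε.ne')
    have hev := hcont.eventually_lt (g := fun _ => (1 : ℝ)) continuousAt_const (by
      simp only [sub_self, Real.rpow_zero]; linarith)
    obtain ⟨s, hs, hs'⟩ := ((hev.filter_mono nhdsWithin_le_nhds).and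
      (Ioo_mem_nhdsLT (show (0 : ℝ) < 1 from one_pos))).exists
    exact ⟨s, hs'.1, hs'.2, hs⟩
  have hεs : 0 < ε ^ (s - 1) := Real.rpow_pos_of_pos hε _
  refine ⟨δ, s, (1 + ρ) / 2 * ε ^ (s - 1), hδ0, hs0, hs1,
    mul_nonneg (by linarith) hεs.le, hsκ, fun l hl r hr hrs => ?_⟩
  have hδ2 : 0 < 1 + δ := by linarith
  have hC : 0 ≤ ε ^ (s - 1) * (1 + δ) := mul_nonneg hεs.le hδ2.le
  have hrs' : ∀ i, r i ^ s ≤ ε ^ (s - 1) * (1 + δ) * (r i / (1 + δ)) := by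
    intro i
    have hri := hε.trans_le (hr i)
    rw [mul_assoc, mul_div_cancel₀ _ hδ2.ne']
    calc r i ^ s = r i ^ (s - 1) * r i := by
          rw [← Real.rpow_add_one hri.ne', sub_add_cancel]
      _ ≤ ε ^ (s - 1) * r i := mul_le_mul_of_nonneg_right
          (Real.rpow_le_rpow_of_nonpos hε (hr i) (by linarith)) hri.le
  calc twoStep a b c l (fun i => r i ^ s)
      ≤ twoStep a b c l (fun i => ε ^ (s - 1) * (1 + δ) * (r i / (1 + δ))) :=
        twoStep_mono h hl hrs'
    _ = ε ^ (s - 1) * (1 + δ) * twoStep a b c l (fun i => r i / (1 + δ)) := twoStep_smul hC _ _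
    _ ≤ ε ^ (s - 1) * (1 + δ) * ρ := by
        refine mul_le_mul_of_nonneg_left (hle l hl _ (fun i => ?_) ?_) hC
        · rw [le_div_iff₀ hδ2]
          nlinarith [hr i]
        · rw [← Finset.sum_div, div_le_one hδ2]
          exact hrs
    _ = (1 + ρ) / 2 * ε ^ (s - 1) := by rw [mul_assoc, hδρ, mul_comm]

end Constants

/-! ### The conjugacy at the end points, and its singularity -/

section Conjugacy

variable {N : ℕ} {f g : Fin N → I → I} {a b c d : Fin N → ℝ} {φ : I → I}

theorem IsConjSolution.map_zero (hφ : IsConjSolution f g φ) (hf : IsCompatibleSystem f)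
    (hg : IsLFSystem g a b c d) (hd : ∀ i, d i = 1) (hN : 2 ≤ N) : φ 0 = 0 := by
  let i : Fin N := ⟨0, by omega⟩
  have h := congrFun (hφ.conj i) 0
  simp only [Function.comp_apply, hf.first i rfl] at h
  exact Subtype.ext (hg.eq_zero_of_fixed hd hN (i := i) rfl h)

theorem IsConjSolution.map_one (hφ : IsConjSolution f g φ) (hf : IsCompatibleSystem f)
    (hg : IsLFSystem g a b c d) (hd : ∀ i, d i = 1) (hN : 2 ≤ N) : φ 1 = 1 := by
  let i : Fin N := ⟨N - 1, by omega⟩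
  have hi : (i : ℕ) + 1 = N := by simp only [i]; omega
  have h := congrFun (hφ.conj i) 1
  simp only [Function.comp_apply, hf.last i hi] at h
  exact Subtype.ext (hg.eq_one_of_fixed hd hN hi h)

end Conjugacy

theorem theorem3p2 {N : ℕ} (hN : 2 ≤ N) (g : Fin N → unitInterval → unitInterval)
    (a b c d : Fin N → ℝ) (hg : IsLFSystem g a b c d) (hd : ∀ i, d i = 1)
    (hp : 2 ≤ (lfFixVectors a b c).encard) :
    ∀ ε : ℝ, 0 < ε → ε < 1 / 2 →
      ∃ δ : ℝ, 0 < δ ∧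
        ∀ f : Fin N → unitInterval → unitInterval, IsContractiveSystem f →
          (∀ i, ENNReal.ofReal ε ≤ lipConst (f i) ∧ lipConst (f i) ≤ ENNReal.ofReal (1 - ε)) →
          ∑ i, lipConst (f i) < ENNReal.ofReal (1 + δ) →
          ∀ (φ : unitInterval → unitInterval) (hφ : IsConjSolution f g φ),
            dimHMeasure (distMeasure φ hφ.continuous hφ.strictMono) < 1 ∧
              IsSingularFunction φ := by
  intro ε hε hε2
  have h := hg.isLFData hd
  have hfix : ¬ ∃ y : ℝ, -1 < y ∧ ∀ i, b i * y ^ 2 + (1 - a i) * y - c i = 0 := by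
    rintro ⟨y, hy, hy'⟩
    have h1 := Set.encard_le_one_iff_subsingleton.2 (lfFixVectors_subsingleton h hN hy hy')
    have h2 := hp.trans h1
    norm_num at h2
  obtain ⟨δ, s, κ, hδ, hs0, hs1, hκ0, hκ1, hκ⟩ := h.exists_twoStep_rpow_le hN hfix hε
  refine ⟨δ, hδ, fun f hf hlip hsum φ hφ => ?_⟩
  set r : Fin N → ℝ := fun i => (lipConst (f i)).toReal with hr
  have htop : ∀ i, lipConst (f i) ≠ ∞ := fun i => (hf.contraction i).ne_top
  have hrε : ∀ i, ε ≤ r i := fun i => (ENNReal.ofReal_le_iff_le_toReal (htop i)).1 (hlip i).1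
  have hr0 : ∀ i, 0 ≤ r i := fun i => ENNReal.toReal_nonneg
  have hr1 : ∀ i, r i ≤ 1 - ε := fun i =>
    ENNReal.toReal_le_of_le_ofReal (by linarith) (hlip i).2
  have hrs : ∑ i, r i ≤ 1 + δ := by
    rw [hr, ← ENNReal.toReal_sum fun i _ => htop i]
    exact ENNReal.toReal_le_of_le_ofReal (by linarith) hsum.le
  have hφ0 := hφ.map_zero hf.compatible hg hd hN
  have hφ1 := hφ.map_one hf.compatible hg hd hN
  have hmono : ∀ n w, Monotone (wordMap f n w) :=
    wordMap_monotone fun i => (hf.compatible.strictMono i).monotone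
  have hT : ∀ i, ∀ l ∈ Icc (0 : ℝ) 1, tiltNext a b c i l ∈ Icc (0 : ℝ) 1 :=
    fun i l hl => h.tiltNext_mem i hl
  have hP : ∀ i, ∀ l ∈ Icc (0 : ℝ) 1, 0 ≤ tiltProb a b c i l :=
    fun i l hl => h.tiltProb_nonneg i hl
  have hhalf : (1 / 2 : ℝ) ∈ Icc (0 : ℝ) 1 := by norm_num
  have hdim : dimHMeasure (distMeasure φ hφ.continuous hφ.strictMono) ≤ ENNReal.ofReal s := by
    refine dimHMeasure_le_of_sum_sqrt_le
      (J := fun n (w : Fin (2 * n) → Fin N) =>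
        Icc ((wordMap f (2 * n) w 0 : I) : ℝ) (wordMap f (2 * n) w 1 : I))
      (m := fun n w => wordProb (tiltProb a b c) (tiltNext a b c) (2 * n) w (1 / 2))
      (ρ := fun n w => ∏ k, r (w k)) (η := fun n => (1 - ε) ^ (2 * n))
      ?_ hs0 hκ0 hκ1 (fun n w => measurableSet_Icc) ?_ ?_ ?_ ?_ ?_ ?_ ?_ ?_ ?_
    · have := distMeasure_Icc hφ.continuous hφ.strictMono 0 1
      simpa [hφ0, hφ1] using this
    · intro n x hx
      obtain ⟨w, y, hy⟩ := exists_wordMap_eq (hf.compatible.exists_eq (by omega)) (2 * n) ⟨x, hx⟩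
      refine mem_iUnion.2 ⟨w, ?_, ?_⟩
      · have : wordMap f (2 * n) w 0 ≤ ⟨x, hx⟩ := hy ▸ hmono _ w unitInterval.nonneg'
        exact this
      · have : (⟨x, hx⟩ : I) ≤ wordMap f (2 * n) w 1 := hy ▸ hmono _ w unitInterval.le_one'
        exact this
    · exact fun n w => wordProb_nonneg hT hP _ w hhalf
    · intro n w
      rw [distMeasure_Icc, wordMap_conj hφ.conj, wordMap_conj hφ.conj, hφ0, hφ1,
        hg.wordMap_sub hd]
    · exact fun n => (sum_wordProb (fun l => h.sum_tiltProb (by omega) l) _ _).le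
    · exact fun n w => Finset.prod_nonneg fun k _ => hr0 _
    · intro n w
      rw [Real.ediam_Icc]
      apply ENNReal.ofReal_le_ofReal
      have h1 := dist_wordMap_le hr0 (fun i => dist_le_of_lipConst_ne_top (htop i)) (2 * n) w 1 0
      rw [Subtype.dist_eq, Subtype.dist_eq, Real.dist_eq, Real.dist_eq] at h1
      simpa using (le_abs_self _).trans h1
    · intro n w
      refine (Finset.prod_le_prod (fun k _ => hr0 _) fun k _ => hr1 (w k)).trans_eq ?_
      simp
    · simp_rw [pow_mul]
      exact tendsto_pow_atTop_nhds_zero_of_lt_one (sq_nonneg _) (by nlinarith)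
    · intro n
      simp_rw [← Real.finsetProd_rpow _ _ fun k _ => hr0 _]
      exact sum_sqrt_wordProb_le hT hP (fun i => Real.rpow_nonneg (hr0 i) s) hκ0
        (fun l hl => hκ l hl r hrε hrs) n hhalf
  have hdim1 := hdim.trans_lt (ENNReal.ofReal_lt_one.2 hs1)
  exact ⟨hdim1, isSingularFunction_of_dimHMeasure_lt_one _ _ hφ0 hφ1 hdim1⟩
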